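/- Let $\varphi\in L^1(\mathbb R)$ (complex valued) be nontrivial, i.e. not almost everywhere zero. For $s\ge 0$ put $$p(s)=-\log\int_{|t|\ge s}|\varphi(t)|\,dt\in(-\infty,+\infty],$$ with $p(s)=+\infty$ if the integral vanishes, and assume that $\lim_{s\to\infty}p(s)/s=\infty$. Let $\widehat\varphi(x)=\int_{-\infty}^{\infty}e^{-ixt}\varphi(t)\,dt$ for $x\in\mathbb R$, and for $\epsilon>0$ let $s_\epsilon=\inf\{s>0:\ e^{-p(s)}\le\epsilon\}$. Let $q>\frac12$ and $\beta>0$ be constants. Then there is $\epsilon_0>0$ (depending on $\varphi,q,\beta$) such that for every $0<\epsilon<\epsilon_0$ the equation $$\Big[\big(q+\tfrac12\big)\log R_\epsilon+\log(15e^3)\Big]\Big[\log\|\varphi\|_{L^1(\mathbb R)}+2e\,s_\epsilon R_\epsilon\Big]=-\log(\epsilon^\beta+\epsilon)$$ has a solution $R_\epsilon>0$, and every solution $R_\epsilon>0$ satisfies $$m\big(\{x\in\mathbb R:\ |\widehat\varphi(x)|\le\epsilon^\beta,\ |x|\le R_\epsilon\}\big)\le R_\epsilon^{-q+\frac12},$$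 where $m$ is Lebesgue measure on $\mathbb R$. -/

import Mathlib

open MeasureTheory Filter Topology

noncomputable section

namespace Deconvolution

/-- The Fourier transform `∫ e^{-ixt} φ(t) dt`, with this normalisation. -/
def fourierHat (φ : ℝ → ℂ) (x : ℝ) : ℂ :=
  ∫ t : ℝ, Complex.exp (-(Complex.I * (x : ℂ) * (t : ℂ))) * φ t

/-- `p(s) = - log ∫_{|t| ≥ s} |φ(t)| dt`, extended-real valued: it is `⊤` (that is `-log 0`)
as soon as `φ` vanishes almost everywhere on `{|t| ≥ s}`. -/
def tailExponent (φ : ℝ → ℂ) (s : ℝ) : EReal :=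
  -ENNReal.log (∫⁻ t in {t : ℝ | s ≤ |t|}, ‖φ t‖ₑ)

/-- `s_ε = inf {s > 0 : e^{-p(s)} ≤ ε}`. -/
def truncationRadius (φ : ℝ → ℂ) (ε : ℝ) : ℝ :=
  sInf {s : ℝ | 0 < s ∧ EReal.exp (-tailExponent φ s) ≤ ENNReal.ofReal ε}

/-- The implicit equation that `R = R_ε` has to satisfy. -/
def RadiusEquation (φ : ℝ → ℂ) (q β ε R : ℝ) : Prop :=
  ((q + 1 / 2) * Real.log R + Real.log (15 * Real.exp 1 ^ 3)) *
      (Real.log (∫ t : ℝ, ‖φ t‖) + 2 * Real.exp 1 * truncationRadius φ ε * R) =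
    -Real.log (ε ^ β + ε)

/-- The real small-value set `{x ∈ ℝ : |φ̂(x)| ≤ δ, |x| ≤ R}`. -/
def smallValueSet (φ : ℝ → ℂ) (δ R : ℝ) : Set ℝ :=
  {x : ℝ | ‖fourierHat φ x‖ ≤ δ ∧ |x| ≤ R}

end Deconvolution

end

/-!
Cutting `φ` off at a point `s` slightly beyond `s_ε` changes `φ̂` by at most `ε` on the real line
and replaces it by an entire function `F` with `|F z| ≤ ‖φ‖₁ e^{s |z|}`. By injectivity of the
Fourier transform, `φ̂ x₀ ≠ 0` for some `x₀`, and `|F x₀|` is then bounded below uniformly in `ε`.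

Divide `F` by the monic polynomial `P` of its zeros in a disc about `x₀` that contains `[-R, R]`.
By the maximum principle on a larger disc, `F` has `O(s R)` zeros there, and the zero-free
cofactor is bounded below by Borel–Carathéodory. If `E ⊆ [-R, R]` has measure `m`, then
`∫ log⁺(m / |x - b|) dx = 2 m` for every real `b`, so averaging over `E` the sum of these
functions over the real parts of the zeros of `P` yields a point of `E` where
`|P| ≥ (m e⁻²) ^ deg P`.

Hence, for large `R`, some point of every `E` with `m > R ^ (-q + 1/2)` has
`|F| > e^{-Λ} = ε^β + ε`, where `Λ` is the left-hand side of the radius equation, so that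
`|φ̂| > ε^β` there. The condition on `p` gives `s_ε = o(log (1/ε))`; therefore a solution `R` is
large as soon as `ε` is small, unless the logarithmic factor of the equation is negative, in which
case `[-R, R]` itself has measure at most `R ^ (-q + 1/2)`.
-/

namespace Deconvolution

section MonicPolynomials

open Polynomial Real

theorem integral_posLog_div_abs {m : ℝ} (hm : 0 < m) : ∫ x : ℝ, log⁺ (m / |x|) = 2 * m := by
  have hsupp : ∀ x ∈ Set.Ioi 0 \ Set.Ioc 0 m, log⁺ (m / x) = 0 := by
    rintro x ⟨hx, hxm⟩
    rw [posLog_eq_zero_iff, abs_of_nonneg (div_nonneg hm.le (le_of_lt hx)), div_le_one hx]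
    exact (not_le.1 fun h => hxm ⟨hx, h⟩).le
  have hlog : ∀ x ∈ Set.Ioc 0 m, log⁺ (m / x) = log m - log x := by
    rintro x ⟨hx, hxm⟩
    rw [posLog_eq_log (((one_le_div hx).2 hxm).trans (le_abs_self _)), log_div hm.ne' hx.ne']
  rw [integral_comp_abs (f := fun x => log⁺ (m / x)),
    setIntegral_eq_of_subset_of_forall_sdiff_eq_zero measurableSet_Ioi Set.Ioc_subset_Ioi_self
      hsupp, setIntegral_congr_fun measurableSet_Ioc hlog,
    ← intervalIntegral.integral_of_le hm.le,
    intervalIntegral.integral_sub intervalIntegrable_const intervalIntegral.intervalIntegrable_log',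
    intervalIntegral.integral_const, integral_log_from_zero, smul_eq_mul]
  ring

theorem integral_posLog_div_abs_sub {m : ℝ} (hm : 0 < m) (b : ℝ) :
    ∫ x : ℝ, log⁺ (m / |x - b|) = 2 * m := by
  rw [integral_sub_right_eq_self (fun x => log⁺ (m / |x|)) b, integral_posLog_div_abs hm]

theorem integrable_posLog_div_abs_sub {m : ℝ} (hm : 0 < m) (b : ℝ) :
    Integrable fun x : ℝ => log⁺ (m / |x - b|) :=
  .of_integral_ne_zero (by rw [integral_posLog_div_abs_sub hm b]; positivity)

theorem integrable_sum_posLog_div_abs_sub {m : ℝ} (hm : 0 < m) (s : Multiset ℝ) :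
    Integrable fun x : ℝ => (s.map fun b => log⁺ (m / |x - b|)).sum := by
  induction s using Multiset.induction_on with
  | empty => simp
  | cons b s ih =>
    simp only [Multiset.map_cons, Multiset.sum_cons]
    exact (integrable_posLog_div_abs_sub hm b).add ih

theorem integral_sum_posLog_div_abs_sub {m : ℝ} (hm : 0 < m) (s : Multiset ℝ) :
    ∫ x : ℝ, (s.map fun b => log⁺ (m / |x - b|)).sum = s.card * (2 * m) := by
  induction s using Multiset.induction_on with
  | empty => simp
  | cons b s ih =>
    simp only [Multiset.map_cons, Multiset.sum_cons, Multiset.card_cons]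
    rw [integral_add (integrable_posLog_div_abs_sub hm b) (integrable_sum_posLog_div_abs_sub hm s),
      ih, integral_posLog_div_abs_sub hm]
    push_cast
    ring

theorem exists_mem_sum_posLog_div_abs_sub_le {E : Set ℝ} (h0 : volume E ≠ 0) (htop : volume E ≠ ⊤)
    (s : Multiset ℝ) : ∃ x ∈ E, x ∉ s ∧
      (s.map fun b => log⁺ (volume.real E / |x - b|)).sum ≤ 2 * s.card := by
  classical
  set m := volume.real E
  have hm : 0 < m := ENNReal.toReal_pos h0 htop
  have hnull : volume (s.toFinset : Set ℝ) = 0 := s.toFinset.finite_toSet.measure_zero _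
  have hvol : volume (E \ s.toFinset) = volume E := measure_sdiff_null hnull
  have hint := integrable_sum_posLog_div_abs_sub hm s
  obtain ⟨x, hx, hle⟩ := exists_le_setAverage (s := E \ s.toFinset) (hvol ▸ h0) (hvol ▸ htop)
    hint.integrableOn
  refine ⟨x, hx.1, fun h => hx.2 (by simpa using h), hle.trans ?_⟩
  have hnonneg : ∀ x, 0 ≤ (s.map fun b => log⁺ (m / |x - b|)).sum := fun x =>
    Multiset.sum_nonneg fun _ hy => by
      obtain ⟨b, -, rfl⟩ := Multiset.mem_map.1 hy
      exact posLog_nonneg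
  rw [setAverage_eq, measureReal_def, hvol, ← measureReal_def, smul_eq_mul, inv_mul_le_iff₀ hm]
  calc _ ≤ ∫ x, (s.map fun b => log⁺ (m / |x - b|)).sum :=
        setIntegral_le_integral hint (.of_forall hnonneg)
    _ = m * (2 * s.card) := by rw [integral_sum_posLog_div_abs_sub hm]; ring

theorem mul_exp_neg_posLog_div_le {m y : ℝ} (hy : 0 < y) : m * exp (-log⁺ (m / y)) ≤ y := by
  rw [exp_neg, ← div_eq_mul_inv, div_le_comm₀ (exp_pos _) hy]
  exact (le_exp_log _).trans (exp_le_exp.2 (le_max_right _ _))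

theorem pow_card_mul_exp_neg_sum_posLog_le {m x : ℝ} (hm : 0 ≤ m) {s : Multiset ℂ}
    (hx : x ∉ s.map Complex.re) :
    m ^ s.card * exp (-((s.map Complex.re).map fun b => log⁺ (m / |x - b|)).sum) ≤
      (s.map fun a => ‖(x : ℂ) - a‖).prod := by
  induction s using Multiset.induction_on with
  | empty => simp
  | cons a s ih =>
    simp only [Multiset.map_cons, Multiset.mem_cons, not_or] at hx
    have ha : m * exp (-log⁺ (m / |x - a.re|)) ≤ ‖(x : ℂ) - a‖ :=
      (mul_exp_neg_posLog_div_le (abs_pos.2 (sub_ne_zero.2 hx.1))).trans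
        (by simpa using Complex.abs_re_le_norm ((x : ℂ) - a))
    calc _ = m * exp (-log⁺ (m / |x - a.re|)) * (m ^ s.card *
          exp (-((s.map Complex.re).map fun b => log⁺ (m / |x - b|)).sum)) := by
          simp only [Multiset.map_cons, Multiset.sum_cons, Multiset.card_cons, neg_add, exp_add]
          ring
      _ ≤ _ := by
          rw [Multiset.map_cons, Multiset.prod_cons]
          exact mul_le_mul ha (ih hx.2) (by positivity) (norm_nonneg _)

theorem norm_eval_eq_prod_of_monic {P : ℂ[X]} (hP : P.Monic) (z : ℂ) :
    ‖P.eval z‖ = (P.roots.map fun a => ‖z - a‖).prod := by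
  rw [(IsAlgClosed.splits P).eval_eq_prod_roots_of_monic hP]
  exact (Multiset.prod_hom' _ (normHom (α := ℂ)) _).symm

theorem exists_mem_pow_le_norm_eval_of_monic {P : ℂ[X]} (hP : P.Monic) {E : Set ℝ}
    (h0 : volume E ≠ 0) (htop : volume E ≠ ⊤) :
    ∃ x ∈ E, (volume.real E / exp 2) ^ P.natDegree ≤ ‖P.eval (x : ℂ)‖ := by
  obtain ⟨x, hxE, hx, hle⟩ := exists_mem_sum_posLog_div_abs_sub_le h0 htop (P.roots.map Complex.re)
  refine ⟨x, hxE, ?_⟩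
  rw [Multiset.card_map] at hle
  rw [norm_eval_eq_prod_of_monic hP, ← IsAlgClosed.card_roots_eq_natDegree]
  refine le_trans ?_ (pow_card_mul_exp_neg_sum_posLog_le (m := volume.real E) measureReal_nonneg hx)
  rw [div_pow, div_eq_mul_inv, ← exp_nat_mul, ← exp_neg]
  gcongr
  linarith

theorem norm_eval_le_pow_of_monic {P : ℂ[X]} (hP : P.Monic) {z : ℂ} {t : ℝ}
    (h : ∀ a ∈ P.roots, ‖z - a‖ ≤ t) : ‖P.eval z‖ ≤ t ^ P.natDegree := by
  rw [norm_eval_eq_prod_of_monic hP, ← IsAlgClosed.card_roots_eq_natDegree,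
    ← Multiset.prod_replicate, ← Multiset.map_const']
  exact Multiset.prod_map_le_prod_map₀ _ _ (fun _ _ => norm_nonneg _) h

theorem pow_le_norm_eval_of_monic {P : ℂ[X]} (hP : P.Monic) {z : ℂ} {t : ℝ} (ht : 0 ≤ t)
    (h : ∀ a ∈ P.roots, t ≤ ‖z - a‖) : t ^ P.natDegree ≤ ‖P.eval z‖ := by
  rw [norm_eval_eq_prod_of_monic hP, ← IsAlgClosed.card_roots_eq_natDegree,
    ← Multiset.prod_replicate, ← Multiset.map_const']
  exact Multiset.prod_map_le_prod_map₀ _ _ (fun _ _ => ht) h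

end MonicPolynomials

section ZeroFree

open Metric

theorem exists_eq_mul_cexp_on_ball {g : ℂ → ℂ} {c : ℂ} {r : ℝ} (hr : 0 < r)
    (hg : DifferentiableOn ℂ g (ball c r)) (h0 : ∀ z ∈ ball c r, g z ≠ 0) :
    ∃ h : ℂ → ℂ, DifferentiableOn ℂ h (ball c r) ∧ h c = 0 ∧
      ∀ z ∈ ball c r, g z = g c * Complex.exp (h z) := by
  obtain ⟨h, hc, hh⟩ :=
    ((hg.deriv isOpen_ball).div hg h0).isExactOn_ball.with_val_at c 0
  refine ⟨h, fun z hz => (hh z hz).differentiableAt.differentiableWithinAt, hc, fun z hz => ?_⟩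
  have hder : ∀ w ∈ ball c r, HasDerivAt (fun w => g w * Complex.exp (-h w)) 0 w := fun w hw => by
    have hgw := (hg.differentiableAt (isOpen_ball.mem_nhds hw)).hasDerivAt
    refine (hgw.mul (hh w hw).neg.cexp).congr_deriv ?_
    have := h0 w hw
    simp only [Pi.div_apply, Pi.neg_apply]
    field_simp
    ring
  have hconst : g z * Complex.exp (-h z) = g c * Complex.exp (-h c) :=
    isOpen_ball.is_const_of_deriv_eq_zero (convex_ball c r).isPreconnected
      (fun w hw => (hder w hw).differentiableAt.differentiableWithinAt)
      (fun w hw => (hder w hw).deriv) hz (mem_ball_self hr)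
  rw [hc, neg_zero, Complex.exp_zero, mul_one] at hconst
  rw [← hconst, mul_assoc, ← Complex.exp_add, neg_add_cancel, Complex.exp_zero, mul_one]

theorem norm_center_mul_exp_le_norm_of_ne_zero {g : ℂ → ℂ} {c : ℂ} {r Q : ℝ} (hQ : 0 < Q)
    (hg : DifferentiableOn ℂ g (ball c r)) (h0 : ∀ z ∈ ball c r, g z ≠ 0)
    (hle : ∀ z ∈ ball c r, ‖g z‖ ≤ ‖g c‖ * Real.exp Q) {z : ℂ} (hz : z ∈ ball c r) :
    ‖g c‖ * Real.exp (-(2 * Q * ‖z - c‖ / (r - ‖z - c‖))) ≤ ‖g z‖ := by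
  have hr : 0 < r := pos_of_mem_ball hz
  obtain ⟨h, hd, hc, hh⟩ := exists_eq_mul_cexp_on_ball hr hg h0
  have hgc : 0 < ‖g c‖ := norm_pos_iff.2 (h0 c (mem_ball_self hr))
  have htrans : Set.MapsTo (fun w => w + c) (ball 0 r) (ball c r) := fun w hw => by
    simpa [dist_eq_norm] using hw
  have hmaps : Set.MapsTo (fun w => h (w + c)) (ball 0 r) {w | w.re ≤ Q} := fun w hw => by
    have := hle _ (htrans hw)
    rw [hh _ (htrans hw), norm_mul, Complex.norm_exp] at this
    exact Real.exp_le_exp.1 (le_of_mul_le_mul_left this hgc)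
  have hbc : ‖h z‖ ≤ 2 * Q * ‖z - c‖ / (r - ‖z - c‖) := by
    simpa using Complex.borelCaratheodory_zero (z := z - c) hQ
      (hd.comp (by fun_prop) htrans) hmaps hr (by simpa [dist_eq_norm] using hz) (by simpa using hc)
  rw [hh z hz, norm_mul, Complex.norm_exp]
  gcongr
  linarith [neg_abs_le (h z).re, Complex.abs_re_le_norm (h z)]

end ZeroFree

section ZeroFactorization

open Metric Polynomial

/-- A factorization `f = P g` that splits off zeros of `f` lying in the closed disc of radius `r`
about `c`: the zeros are the roots of the monic polynomial `P`, with multiplicity, and the cofactor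
`g` is holomorphic on the larger disc of radius `ρ`. Some zeros of `f` may remain in `g`. -/
structure IsZeroFactorization (f g : ℂ → ℂ) (P : ℂ[X]) (c : ℂ) (r ρ : ℝ) : Prop where
  monic : P.Monic
  norm_root_sub_le : ∀ a ∈ P.roots, ‖a - c‖ ≤ r
  diffContOnCl : DiffContOnCl ℂ g (ball c ρ)
  eq_mul : ∀ z, f z = P.eval z * g z

namespace IsZeroFactorization

variable {f g : ℂ → ℂ} {P : ℂ[X]} {c : ℂ} {r ρ B : ℝ}

theorem norm_cofactor_mul_pow_le (h : IsZeroFactorization f g P c r ρ) (hr : 0 ≤ r) (hrρ : r < ρ)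
    (hB : ∀ z ∈ sphere c ρ, ‖f z‖ ≤ B) {z : ℂ} (hz : z ∈ closedBall c ρ) :
    ‖g z‖ * (ρ - r) ^ P.natDegree ≤ B := by
  have hρ : ρ ≠ 0 := (hr.trans_lt hrρ).ne'
  have hpos : 0 < (ρ - r) ^ P.natDegree := pow_pos (sub_pos.2 hrρ) _
  rw [← le_div_iff₀ hpos]
  refine Complex.norm_le_of_forall_mem_frontier_norm_le isBounded_ball h.diffContOnCl
    (fun w hw => ?_) (by rwa [closure_ball c hρ])
  rw [frontier_ball c hρ] at hw
  have hroots : ∀ a ∈ P.roots, ρ - r ≤ ‖w - a‖ := fun a ha => by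
    have := norm_sub_norm_le (w - c) (a - c)
    rw [sub_sub_sub_cancel_right, mem_sphere_iff_norm.1 hw] at this
    linarith [h.norm_root_sub_le a ha]
  rw [le_div_iff₀' hpos]
  calc (ρ - r) ^ P.natDegree * ‖g w‖ ≤ ‖P.eval w‖ * ‖g w‖ := by
        gcongr
        exact pow_le_norm_eval_of_monic h.monic (sub_pos.2 hrρ).le hroots
    _ ≤ B := by simpa [h.eq_mul w] using hB w hw

theorem norm_center_le (h : IsZeroFactorization f g P c r ρ) :
    ‖f c‖ ≤ r ^ P.natDegree * ‖g c‖ := by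
  rw [h.eq_mul, norm_mul]
  gcongr
  exact norm_eval_le_pow_of_monic h.monic fun a ha => norm_sub_rev c a ▸ h.norm_root_sub_le a ha

theorem norm_center_mul_pow_le (h : IsZeroFactorization f g P c r ρ) (hr : 0 < r) (hrρ : r < ρ)
    (hB : ∀ z ∈ sphere c ρ, ‖f z‖ ≤ B) : ‖f c‖ * ((ρ - r) / r) ^ P.natDegree ≤ B := by
  have hρr : 0 < ρ - r := sub_pos.2 hrρ
  calc ‖f c‖ * ((ρ - r) / r) ^ P.natDegree
      ≤ r ^ P.natDegree * ‖g c‖ * ((ρ - r) / r) ^ P.natDegree := by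
        gcongr
        exact h.norm_center_le
    _ = ‖g c‖ * (ρ - r) ^ P.natDegree := by
        rw [div_pow]
        field_simp
    _ ≤ B := h.norm_cofactor_mul_pow_le hr.le hrρ hB (mem_closedBall_self (hr.trans hrρ).le)

theorem norm_cofactor_mul_norm_center_le (h : IsZeroFactorization f g P c r ρ) (hr : 0 < r)
    (hrρ : 2 * r ≤ ρ) (hB : ∀ z ∈ sphere c ρ, ‖f z‖ ≤ B) {z : ℂ} (hz : z ∈ closedBall c ρ) :
    ‖g z‖ * ‖f c‖ ≤ ‖g c‖ * B := by
  calc ‖g z‖ * ‖f c‖ ≤ ‖g z‖ * (r ^ P.natDegree * ‖g c‖) := by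
        gcongr
        exact h.norm_center_le
    _ ≤ ‖g z‖ * ((ρ - r) ^ P.natDegree * ‖g c‖) := by
        gcongr
        linarith
    _ = ‖g c‖ * (‖g z‖ * (ρ - r) ^ P.natDegree) := by ring
    _ ≤ ‖g c‖ * B := by
        gcongr
        exact h.norm_cofactor_mul_pow_le hr.le (by linarith) hB hz

theorem dslope (h : IsZeroFactorization f g P c r ρ) (hrρ : r < ρ) {a : ℂ}
    (ha : a ∈ closedBall c r) (hga : g a = 0) :
    IsZeroFactorization f (dslope g a) (P * (X - C a)) c r ρ where
  monic := h.monic.mul (monic_X_sub_C a)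
  norm_root_sub_le b hb := by
    rw [roots_mul (h.monic.mul (monic_X_sub_C a)).ne_zero, roots_X_sub_C, Multiset.mem_add,
      Multiset.mem_singleton] at hb
    rcases hb with hb | rfl
    · exact h.norm_root_sub_le b hb
    · exact mem_closedBall_iff_norm.1 ha
  diffContOnCl := by
    have hball : ball c ρ ∈ 𝓝 a := isOpen_ball.mem_nhds (closedBall_subset_ball hrρ ha)
    exact ⟨(Complex.differentiableOn_dslope hball).2 h.diffContOnCl.differentiableOn,
      (continuousOn_dslope (mem_of_superset hball subset_closure)).2
        ⟨h.diffContOnCl.continuousOn, h.diffContOnCl.differentiableOn.differentiableAt hball⟩⟩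
  eq_mul z := by
    have hz : (z - a) * _root_.dslope g a z = g z := by simpa [hga] using sub_smul_dslope g a z
    simp [h.eq_mul z, ← hz, mul_assoc]

end IsZeroFactorization

theorem exists_isZeroFactorization_ne_zero {f : ℂ → ℂ} {c : ℂ} {r ρ : ℝ} (hr : 0 < r)
    (hrρ : 2 * r < ρ) (hf : DiffContOnCl ℂ f (ball c ρ)) (hfc : f c ≠ 0) :
    ∃ (g : ℂ → ℂ) (P : ℂ[X]), IsZeroFactorization f g P c r ρ ∧ ∀ z ∈ closedBall c r, g z ≠ 0 := by
  by_contra! hcon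
  have hfac : ∀ n : ℕ, ∃ (g : ℂ → ℂ) (P : ℂ[X]),
      IsZeroFactorization f g P c r ρ ∧ P.natDegree = n := by
    intro n
    induction n with
    | zero => exact ⟨f, 1, ⟨monic_one, by simp, hf, by simp⟩, natDegree_one⟩
    | succ n ih =>
      obtain ⟨g, P, h, hn⟩ := ih
      obtain ⟨a, ha, hga⟩ := hcon g P h
      refine ⟨dslope g a, P * (X - C a), h.dslope (by linarith) ha hga, ?_⟩
      rw [h.monic.natDegree_mul (monic_X_sub_C a), natDegree_X_sub_C, hn]
  obtain ⟨B, hB⟩ := (isCompact_sphere c ρ).exists_bound_of_continuousOn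
    (hf.continuousOn_ball.mono sphere_subset_closedBall)
  obtain ⟨n, hn⟩ := pow_unbounded_of_one_lt (B / ‖f c‖)
    (show 1 < (ρ - r) / r by rw [one_lt_div hr]; linarith)
  obtain ⟨g, P, h, rfl⟩ := hfac n
  rw [div_lt_iff₀' (norm_pos_iff.2 hfc)] at hn
  exact hn.not_ge (h.norm_center_mul_pow_le hr (by linarith) hB)

theorem IsZeroFactorization.norm_center_mul_exp_le_norm_cofactor {f g : ℂ → ℂ} {P : ℂ[X]} {c : ℂ}
    {r ρ Q : ℝ} (h : IsZeroFactorization f g P c r ρ) (hrρ : 2 * r ≤ ρ)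
    (hg0 : ∀ z ∈ closedBall c r, g z ≠ 0) (hfc : f c ≠ 0) (hQ : 0 < Q)
    (hfQ : ∀ z ∈ sphere c ρ, ‖f z‖ ≤ ‖f c‖ * Real.exp Q) {z : ℂ} (hz : z ∈ ball c r) :
    ‖g c‖ * Real.exp (-(2 * Q * ‖z - c‖ / (r - ‖z - c‖))) ≤ ‖g z‖ := by
  have hr : 0 < r := pos_of_mem_ball hz
  refine norm_center_mul_exp_le_norm_of_ne_zero hQ
    (h.diffContOnCl.differentiableOn.mono (ball_subset_ball (by linarith)))
    (fun w hw => hg0 w (ball_subset_closedBall hw)) (fun w hw => ?_) hz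
  refine le_of_mul_le_mul_right ?_ (norm_pos_iff.2 hfc)
  exact (h.norm_cofactor_mul_norm_center_le hr hrρ hfQ
    (ball_subset_closedBall (ball_subset_ball (by linarith) hw))).trans_eq (by ring)

theorem volume_le_of_forall_norm_sub_le {E : Set ℝ} {c : ℂ} {t : ℝ}
    (hE : ∀ x ∈ E, ‖(x : ℂ) - c‖ ≤ t) : volume E ≤ ENNReal.ofReal (2 * t) := by
  rw [← Real.volume_closedBall c.re]
  refine measure_mono fun x hx => mem_closedBall_iff_norm.2 ?_
  simpa using (Complex.abs_re_le_norm ((x : ℂ) - c)).trans (hE x hx)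

theorem IsZeroFactorization.exists_mem_norm_mul_exp_le_norm {f g : ℂ → ℂ} {P : ℂ[X]} {c : ℂ}
    {r ρ Q : ℝ} (h : IsZeroFactorization f g P c r ρ) (hr : 0 < r) (hPQ : P.natDegree ≤ Q)
    {E : Set ℝ} (hE : volume E ≠ 0) (hEr : ∀ x ∈ E, ‖(x : ℂ) - c‖ ≤ 4 / 5 * r)
    (hg : ∀ x ∈ E, ‖g c‖ * Real.exp (-(8 * Q)) ≤ ‖g x‖) :
    ∃ x ∈ E, ‖f c‖ * Real.exp (-(Q * (10 + Real.log (r / volume.real E)))) ≤ ‖f x‖ := by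
  have hvol : volume E ≤ ENNReal.ofReal (2 * (4 / 5 * r)) := volume_le_of_forall_norm_sub_le hEr
  have htop : volume E ≠ ⊤ := (hvol.trans_lt ENNReal.ofReal_lt_top).ne
  set m := volume.real E
  have hm : 0 < m := ENNReal.toReal_pos hE htop
  have hmr : m ≤ 8 / 5 * r :=
    (ENNReal.toReal_le_of_le_ofReal (by positivity) hvol).trans_eq (by ring)
  have hlog : 0 ≤ 2 + Real.log (r / m) := by
    have hrm : Real.exp (-2) ≤ r / m := by
      rw [le_div_iff₀ hm]
      nlinarith [Real.exp_neg_one_lt_half, Real.exp_le_exp.2 (show (-2 : ℝ) ≤ -1 by norm_num)]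
    linarith [(Real.le_log_iff_exp_le (div_pos hr hm)).2 hrm]
  obtain ⟨x, hx, hPx⟩ := exists_mem_pow_le_norm_eval_of_monic h.monic hE htop
  refine ⟨x, hx, ?_⟩
  calc ‖f c‖ * Real.exp (-(Q * (10 + Real.log (r / m))))
      ≤ ‖f c‖ * Real.exp (-(P.natDegree * (2 + Real.log (r / m))) - 8 * Q) := by
        gcongr
        linarith [mul_le_mul_of_nonneg_right hPQ hlog]
    _ = ‖f c‖ * (m / Real.exp 2 / r) ^ P.natDegree * Real.exp (-(8 * Q)) := by
        rw [sub_eq_add_neg, Real.exp_add, ← mul_neg, Real.exp_nat_mul, neg_add', Real.exp_sub,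
          Real.exp_neg, Real.exp_log (div_pos hr hm), Real.exp_neg]
        field_simp
    _ ≤ r ^ P.natDegree * ‖g c‖ * (m / Real.exp 2 / r) ^ P.natDegree * Real.exp (-(8 * Q)) := by
        gcongr
        exact h.norm_center_le
    _ = (m / Real.exp 2) ^ P.natDegree * (‖g c‖ * Real.exp (-(8 * Q))) := by
        rw [div_pow _ r]
        field_simp
    _ ≤ ‖P.eval (x : ℂ)‖ * ‖g x‖ := by
        gcongr
        exact hg x hx
    _ = ‖f x‖ := by rw [h.eq_mul, norm_mul]

theorem exists_mem_norm_mul_exp_le_norm {f : ℂ → ℂ} {c : ℂ} {r Q : ℝ} (hr : 0 < r)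
    (hf : DiffContOnCl ℂ f (ball c ((1 + Real.exp 1) * r))) (hfc : f c ≠ 0) (hQ : 0 < Q)
    (hfQ : ∀ z ∈ sphere c ((1 + Real.exp 1) * r), ‖f z‖ ≤ ‖f c‖ * Real.exp Q)
    {E : Set ℝ} (hE : volume E ≠ 0) (hEr : ∀ x ∈ E, ‖(x : ℂ) - c‖ ≤ 4 / 5 * r) :
    ∃ x ∈ E, ‖f c‖ * Real.exp (-(Q * (10 + Real.log (r / volume.real E)))) ≤ ‖f x‖ := by
  have hrρ : 2 * r < (1 + Real.exp 1) * r := by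
    gcongr
    linarith [Real.exp_one_gt_d9]
  obtain ⟨g, P, h, hg0⟩ := exists_isZeroFactorization_ne_zero hr hrρ hf hfc
  have hcard : (P.natDegree : ℝ) ≤ Q := by
    have := h.norm_center_mul_pow_le hr (by linarith) hfQ
    rwa [show ((1 + Real.exp 1) * r - r) / r = Real.exp 1 by field_simp; ring,
      mul_le_mul_iff_right₀ (norm_pos_iff.2 hfc), ← Real.exp_nat_mul, mul_one,
      Real.exp_le_exp] at this
  refine h.exists_mem_norm_mul_exp_le_norm hr hcard hE hEr fun x hx => ?_
  have hxr : ‖(x : ℂ) - c‖ < r := (hEr x hx).trans_lt (by linarith)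
  refine le_trans ?_ (h.norm_center_mul_exp_le_norm_cofactor hrρ.le hg0 hfc hQ hfQ
    (mem_ball_iff_norm.2 hxr))
  gcongr
  rw [div_le_iff₀ (sub_pos.2 hxr)]
  nlinarith [hEr x hx]

end ZeroFactorization

section FourierInjectivity

open FourierTransform

theorem ae_eq_zero_of_fourier_eq_zero {V F : Type*} [NormedAddCommGroup V] [InnerProductSpace ℝ V]
    [FiniteDimensional ℝ V] [MeasurableSpace V] [BorelSpace V] [NormedAddCommGroup F]
    [NormedSpace ℂ F] [CompleteSpace F] {f : V → F} (hf : Integrable f) (h : 𝓕 f = 0) :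
    f =ᵐ[volume] 0 := by
  refine ae_eq_zero_of_integral_contDiff_smul_eq_zero hf.locallyIntegrable fun g hg hgc => ?_
  let G : SchwartzMap V ℂ := (hgc.comp_left (g := Complex.ofRealCLM) rfl).toSchwartzMap
    (Complex.ofRealCLM.contDiff.comp hg)
  have hG : 𝓕 (𝓕⁻ G : SchwartzMap V ℂ) = G := fourier_fourierInv_eq G
  have hflip : ∫ v, 𝓕 ((𝓕⁻ G : SchwartzMap V ℂ) : V → ℂ) v • f v =
      ∫ v, (𝓕⁻ G : SchwartzMap V ℂ) v • 𝓕 f v := by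
    simpa using! VectorFourier.integral_fourierIntegral_smul_eq_flip (L := innerₗ V)
      Real.continuous_fourierChar continuous_inner (𝓕⁻ G : SchwartzMap V ℂ).integrable hf
  rw [← SchwartzMap.fourier_coe, hG, h] at hflip
  calc ∫ v, g v • f v = ∫ v, G v • f v := by
        congr 1
    _ = 0 := by simpa using hflip

theorem fourierHat_two_pi_mul (φ : ℝ → ℂ) (x : ℝ) : fourierHat φ (2 * Real.pi * x) = 𝓕 φ x := by
  rw [Real.fourier_eq', fourierHat]
  congr 1 with t
  rw [smul_eq_mul, RCLike.inner_apply]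
  congr 2
  push_cast
  simp
  ring

theorem exists_fourierHat_ne_zero {φ : ℝ → ℂ} (hφ : Integrable φ) (hφ0 : ¬ φ =ᵐ[volume] 0) :
    ∃ x, fourierHat φ x ≠ 0 := by
  by_contra! h
  exact hφ0 (ae_eq_zero_of_fourier_eq_zero hφ
    (funext fun x => (fourierHat_two_pi_mul φ x).symm.trans (h _)))

end FourierInjectivity

section FourierLaplace

theorem norm_cexp_neg_I_mul_ofReal (x t : ℝ) :
    ‖Complex.exp (-(Complex.I * (x : ℂ) * (t : ℂ)))‖ = 1 := by
  simp [Complex.norm_exp]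

theorem integrable_cexp_mul {φ : ℝ → ℂ} (hφ : Integrable φ) (x : ℝ) :
    Integrable fun t : ℝ => Complex.exp (-(Complex.I * (x : ℂ) * (t : ℂ))) * φ t :=
  hφ.bdd_mul (c := 1) (Continuous.aestronglyMeasurable (by fun_prop))
    (.of_forall fun t => (norm_cexp_neg_I_mul_ofReal x t).le)

theorem norm_fourierHat_le (φ : ℝ → ℂ) (x : ℝ) : ‖fourierHat φ x‖ ≤ ∫ t, ‖φ t‖ := by
  refine (norm_integral_le_integral_norm _).trans_eq ?_
  simp only [norm_mul, norm_cexp_neg_I_mul_ofReal, one_mul]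

theorem fourierHat_sub {φ ψ : ℝ → ℂ} (hφ : Integrable φ) (hψ : Integrable ψ) (x : ℝ) :
    fourierHat (φ - ψ) x = fourierHat φ x - fourierHat ψ x := by
  simp only [fourierHat, Pi.sub_apply, mul_sub]
  exact integral_sub (integrable_cexp_mul hφ x) (integrable_cexp_mul hψ x)

/-- The Fourier–Laplace transform: the extension of `fourierHat φ` to complex frequencies. It is
only used for compactly supported `φ`, for which the integral converges. -/
noncomputable def fourierLaplace (φ : ℝ → ℂ) (z : ℂ) : ℂ :=
  ∫ t : ℝ, Complex.exp (-(Complex.I * z * (t : ℂ))) * φ t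

theorem fourierLaplace_ofReal (φ : ℝ → ℂ) (x : ℝ) : fourierLaplace φ x = fourierHat φ x := rfl

variable {φ : ℝ → ℂ} {s : ℝ}

theorem norm_cexp_mul_le (hs : Function.support φ ⊆ Set.Icc (-s) s) (z : ℂ) (t : ℝ) :
    ‖Complex.exp (-(Complex.I * z * (t : ℂ))) * φ t‖ ≤ Real.exp (s * ‖z‖) * ‖φ t‖ := by
  by_cases ht : φ t = 0
  · simp [ht]
  rw [norm_mul, Complex.norm_exp]
  gcongr
  calc (-(Complex.I * z * (t : ℂ))).re ≤ ‖-(Complex.I * z * (t : ℂ))‖ := Complex.re_le_norm _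
    _ = |t| * ‖z‖ := by simp [mul_comm]
    _ ≤ s * ‖z‖ := by
      gcongr
      exact abs_le.2 (hs ht)

theorem norm_fourierLaplace_le (hφ : Integrable φ) (hs : Function.support φ ⊆ Set.Icc (-s) s)
    (z : ℂ) : ‖fourierLaplace φ z‖ ≤ (∫ t, ‖φ t‖) * Real.exp (s * ‖z‖) :=
  (norm_integral_le_of_norm_le (hφ.norm.const_mul _) (.of_forall (norm_cexp_mul_le hs z))).trans_eq
    (by rw [integral_const_mul, mul_comm])

theorem integrable_I_mul_mul (hφ : Integrable φ) (hs : Function.support φ ⊆ Set.Icc (-s) s) :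
    Integrable fun t : ℝ => -(Complex.I * t) * φ t := by
  refine (hφ.norm.const_mul s).mono'
    ((Continuous.aestronglyMeasurable (by fun_prop)).mul hφ.aestronglyMeasurable)
    (.of_forall fun t => ?_)
  by_cases ht : φ t = 0
  · simp [ht]
  rw [norm_mul]
  gcongr
  simpa using abs_le.2 (hs ht)

theorem hasDerivAt_fourierLaplace (hφ : Integrable φ) (hs : Function.support φ ⊆ Set.Icc (-s) s)
    (z : ℂ) : HasDerivAt (fourierLaplace φ)
    (fourierLaplace (fun t => -(Complex.I * t) * φ t) z) z := by
  have hmeas : ∀ {ψ : ℝ → ℂ}, Integrable ψ → ∀ w : ℂ, AEStronglyMeasurable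
      (fun t : ℝ => Complex.exp (-(Complex.I * w * (t : ℂ))) * ψ t) volume := fun hψ w =>
    (Continuous.aestronglyMeasurable (by fun_prop)).mul hψ.aestronglyMeasurable
  have hφ' := integrable_I_mul_mul hφ hs
  have hs' : Function.support (fun t : ℝ => -(Complex.I * t) * φ t) ⊆ Set.Icc (-s) s :=
    (Function.support_mul_subset_right _ _).trans hs
  refine (hasDerivAt_integral_of_dominated_loc_of_deriv_le
    (F' := fun w t => Complex.exp (-(Complex.I * w * (t : ℂ))) * (-(Complex.I * t) * φ t))
    (bound := fun t => Real.exp (|s| * (‖z‖ + 1)) * ‖-(Complex.I * t) * φ t‖)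
    (Metric.ball_mem_nhds z one_pos) (.of_forall (hmeas hφ))
    ((hφ.norm.const_mul _).mono' (hmeas hφ z) (.of_forall (norm_cexp_mul_le hs z)))
    (hmeas hφ' z) (.of_forall fun t w hw => ?_) (hφ'.norm.const_mul _)
    (.of_forall fun t w _ => ?_)).2
  · refine (norm_cexp_mul_le hs' w t).trans ?_
    have hw1 : ‖w‖ ≤ ‖z‖ + 1 := by
      linarith [norm_sub_norm_le w z, mem_ball_iff_norm.1 hw]
    gcongr
    exact le_abs_self s
  · have hlin : HasDerivAt (fun w : ℂ => -(Complex.I * w * (t : ℂ))) (-(Complex.I * t)) w := by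
      simpa using! (((hasDerivAt_id w).const_mul Complex.I).mul_const (t : ℂ)).neg
    exact (hlin.cexp.mul_const (φ t)).congr_deriv (mul_assoc _ _ _)

theorem differentiable_fourierLaplace (hφ : Integrable φ)
    (hs : Function.support φ ⊆ Set.Icc (-s) s) : Differentiable ℂ (fourierLaplace φ) :=
  fun z => (hasDerivAt_fourierLaplace hφ hs z).differentiableAt

end FourierLaplace

section Truncation

variable {φ : ℝ → ℂ}

/-- The admissible truncation points at level `ε`, those whose tail of `φ` has mass at most `ε`;
`truncationRadius φ ε` is their infimum. -/
def truncationSet (φ : ℝ → ℂ) (ε : ℝ) : Set ℝ :=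
  {s | 0 < s ∧ EReal.exp (-tailExponent φ s) ≤ ENNReal.ofReal ε}

theorem exp_neg_tailExponent (φ : ℝ → ℂ) (s : ℝ) :
    EReal.exp (-tailExponent φ s) = ∫⁻ t in {t : ℝ | s ≤ |t|}, ‖φ t‖ₑ := by
  simp [tailExponent]

theorem measurableSet_le_abs (s : ℝ) : MeasurableSet {t : ℝ | s ≤ |t|} :=
  measurableSet_le measurable_const continuous_abs.measurable

theorem truncationRadius_nonneg (φ : ℝ → ℂ) (ε : ℝ) : 0 ≤ truncationRadius φ ε :=
  Real.sInf_nonneg fun _ hs => hs.1.le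

theorem truncationRadius_le_of_mem {ε s : ℝ} (hs : s ∈ truncationSet φ ε) :
    truncationRadius φ ε ≤ s :=
  csInf_le ⟨0, fun _ ht => ht.1.le⟩ hs

theorem exists_mem_truncationSet_lt {ε t : ℝ} (hne : (truncationSet φ ε).Nonempty)
    (ht : truncationRadius φ ε < t) : ∃ s ∈ truncationSet φ ε, s < t :=
  exists_lt_of_csInf_lt hne ht

theorem norm_fourierHat_indicator_sub_le (hφ : Integrable φ) {s ε : ℝ} (hε : 0 ≤ ε)
    (hs : s ∈ truncationSet φ ε) (x : ℝ) :
    ‖fourierHat ({t : ℝ | s ≤ |t|}ᶜ.indicator φ) x - fourierHat φ x‖ ≤ ε := by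
  have hS := measurableSet_le_abs s
  rw [norm_sub_rev, ← fourierHat_sub hφ (hφ.indicator hS.compl), Set.indicator_compl,
    sub_sub_cancel]
  refine (norm_fourierHat_le _ x).trans ?_
  rw [integral_norm_eq_lintegral_enorm (hφ.indicator hS).aestronglyMeasurable]
  refine ENNReal.toReal_le_of_le_ofReal hε ?_
  simpa only [enorm_indicator_eq_indicator_enorm, lintegral_indicator hS, exp_neg_tailExponent]
    using hs.2

theorem eventually_mul_neg_log_mem_truncationSet
    (hp : Tendsto (fun s : ℝ => tailExponent φ s / (s : EReal)) atTop (𝓝 ⊤)) {η : ℝ}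
    (hη : 0 < η) : ∀ᶠ ε : ℝ in 𝓝[>] 0, η * -Real.log ε ∈ truncationSet φ ε := by
  have hlog : Tendsto (fun ε : ℝ => η * -Real.log ε) (𝓝[>] 0) atTop :=
    (tendsto_neg_atBot_atTop.comp Real.tendsto_log_nhdsGT_zero).const_mul_atTop hη
  filter_upwards [hlog.eventually (hp.eventually_const_lt (EReal.coe_lt_top η⁻¹)),
    hlog.eventually_gt_atTop 0, self_mem_nhdsWithin] with ε hdiv hpos (hε : 0 < ε)
  refine ⟨hpos, ?_⟩
  rw [EReal.lt_div_iff (by exact_mod_cast hpos) (EReal.coe_ne_top _), ← EReal.coe_mul,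
    inv_mul_cancel_left₀ hη.ne'] at hdiv
  calc EReal.exp (-tailExponent φ (η * -Real.log ε)) ≤ EReal.exp (Real.log ε : ℝ) :=
        EReal.exp_monotone (EReal.neg_le.1 (by simpa using hdiv.le))
    _ = ENNReal.ofReal ε := by rw [EReal.exp_coe, Real.exp_log hε]

theorem eventually_truncationSet_nonempty
    (hp : Tendsto (fun s : ℝ => tailExponent φ s / (s : EReal)) atTop (𝓝 ⊤)) :
    ∀ᶠ ε : ℝ in 𝓝[>] 0, (truncationSet φ ε).Nonempty :=
  (eventually_mul_neg_log_mem_truncationSet hp one_pos).mono fun _ h => ⟨_, h⟩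

theorem truncationRadius_isLittleO_log
    (hp : Tendsto (fun s : ℝ => tailExponent φ s / (s : EReal)) atTop (𝓝 ⊤)) :
    truncationRadius φ =o[𝓝[>] 0] Real.log := by
  refine Asymptotics.isLittleO_iff.2 fun η hη => ?_
  filter_upwards [eventually_mul_neg_log_mem_truncationSet hp hη] with ε hε
  rw [Real.norm_of_nonneg (truncationRadius_nonneg φ ε)]
  exact (truncationRadius_le_of_mem hε).trans
    (mul_le_mul_of_nonneg_left (neg_le_abs _) hη.le)

theorem exists_tail_ne_zero (hφ : Integrable φ) (hφ0 : ¬ φ =ᵐ[volume] 0) :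
    ∃ s : ℝ, 0 < s ∧ ∫⁻ t in {t : ℝ | s ≤ |t|}, ‖φ t‖ₑ ≠ 0 := by
  by_contra! hzero
  refine hφ0 ?_
  have htail : ∀ n : ℕ, ∀ᵐ t : ℝ, 1 / ((n : ℝ) + 1) ≤ |t| → φ t = 0 := fun n => by
    have := hzero (1 / ((n : ℝ) + 1)) (by positivity)
    rw [lintegral_eq_zero_iff' hφ.aestronglyMeasurable.enorm.restrict, EventuallyEq,
      ae_restrict_iff' (measurableSet_le_abs _)] at this
    filter_upwards [this] with t ht hle
    simpa using ht hle
  have hne : ∀ᵐ t : ℝ, t ≠ 0 := by simp [ae_iff]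
  filter_upwards [ae_all_iff.2 htail, hne] with t ht ht0
  obtain ⟨n, hn⟩ := exists_nat_one_div_lt (abs_pos.2 ht0)
  exact ht n hn.le

theorem exists_pos_eventually_le_truncationRadius (hφ : Integrable φ) (hφ0 : ¬ φ =ᵐ[volume] 0)
    (hp : Tendsto (fun s : ℝ => tailExponent φ s / (s : EReal)) atTop (𝓝 ⊤)) :
    ∃ s₁ : ℝ, 0 < s₁ ∧ ∀ᶠ ε : ℝ in 𝓝[>] 0, s₁ ≤ truncationRadius φ ε := by
  obtain ⟨s₁, hs₁, htail⟩ := exists_tail_ne_zero hφ hφ0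
  have hsmall : ∀ᶠ ε : ℝ in 𝓝[>] 0,
      ENNReal.ofReal ε < ∫⁻ t in {t : ℝ | s₁ ≤ |t|}, ‖φ t‖ₑ := by
    have hlim : Tendsto ENNReal.ofReal (𝓝[>] 0) (𝓝 0) := by
      simpa using (ENNReal.tendsto_ofReal (tendsto_id (α := ℝ) (x := 𝓝 0))).mono_left
        (nhdsWithin_le_nhds (s := Set.Ioi 0))
    exact hlim.eventually_lt_const (pos_iff_ne_zero.2 htail)
  refine ⟨s₁, hs₁, ?_⟩
  filter_upwards [hsmall, eventually_truncationSet_nonempty hp] with ε hε hne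
  refine le_csInf hne fun s ⟨_, hle⟩ => ?_
  by_contra! hlt
  rw [exp_neg_tailExponent] at hle
  exact hle.not_gt (hε.trans_le (lintegral_mono_set fun t ht => hlt.le.trans ht))

theorem neg_log_rpow_add_self_ge {β ε : ℝ} (hε : 0 < ε) (hε1 : ε < 1) :
    min β 1 * (-Real.log ε) - Real.log 2 ≤ -Real.log (ε ^ β + ε) := by
  have hpow : ε ^ β ≤ ε ^ min β 1 :=
    Real.rpow_le_rpow_of_exponent_ge hε hε1.le (min_le_left _ _)
  have hself : ε ≤ ε ^ min β 1 := by
    simpa using Real.rpow_le_rpow_of_exponent_ge hε hε1.le (min_le_right β 1)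
  have hlog : Real.log (ε ^ β + ε) ≤ Real.log (2 * ε ^ min β 1) :=
    Real.log_le_log (by positivity) (by linarith)
  rw [Real.log_mul two_ne_zero (by positivity), Real.log_rpow hε] at hlog
  linarith

theorem tendsto_neg_log_rpow_add_self_sub_mul_truncationRadius
    (hp : Tendsto (fun s : ℝ => tailExponent φ s / (s : EReal)) atTop (𝓝 ⊤)) {β : ℝ}
    (hβ : 0 < β) (b : ℝ) :
    Tendsto (fun ε => -Real.log (ε ^ β + ε) - b * truncationRadius φ ε) (𝓝[>] 0) atTop := by
  have hγ : 0 < min β 1 := lt_min hβ one_pos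
  have hlog : Tendsto (fun ε : ℝ => min β 1 / 2 * -Real.log ε - Real.log 2) (𝓝[>] 0) atTop :=
    tendsto_atTop_add_const_right _ _
      ((tendsto_neg_atBot_atTop.comp Real.tendsto_log_nhdsGT_zero).const_mul_atTop (by positivity))
  refine tendsto_atTop_mono' _ ?_ hlog
  filter_upwards [((truncationRadius_isLittleO_log hp).const_mul_left b).bound (half_pos hγ),
    Ioo_mem_nhdsGT one_pos] with ε hε ⟨hε0, hε1⟩
  rw [Real.norm_eq_abs, Real.norm_eq_abs, abs_of_neg (Real.log_neg hε0 hε1)] at hε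
  linarith [neg_log_rpow_add_self_ge (β := β) hε0 hε1, (le_abs_self _).trans hε]

end Truncation

section ExponentialType

-- The rate `52/10` has to exceed `11/10 · 5/4 · (1 + e)`, which is about `5.113`, and to stay below
-- the `2e` of `RadiusEquation`; the slack absorbs the constants `A`, `c` and `x₀` for large `R`.
theorem norm_le_norm_mul_exp_of_mem_sphere {F : ℂ → ℂ} {A σ c x₀ R s : ℝ} (hA : 0 ≤ A)
    (hσ : 0 ≤ σ) (hσs : σ ≤ 11 / 10 * s) (hFA : ∀ z, ‖F z‖ ≤ A * Real.exp (σ * ‖z‖))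
    (hc : c ≤ ‖F x₀‖) (hx₀ : |x₀| ≤ R / 1000) (hAc : A ≤ c * Real.exp (8 / 100 * (s * R))) {z : ℂ}
    (hz : z ∈ Metric.sphere (x₀ : ℂ) ((1 + Real.exp 1) * (5 / 4 * (R + |x₀|)))) :
    ‖F z‖ ≤ ‖F x₀‖ * Real.exp (52 / 10 * (s * R)) := by
  have hR : 0 ≤ R := by linarith [abs_nonneg x₀]
  have hzR : ‖z‖ ≤ 4654 / 1000 * R := by
    calc ‖z‖ ≤ ‖(x₀ : ℂ)‖ + ‖z - x₀‖ := norm_le_norm_add_norm_sub' z x₀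
      _ = |x₀| + (1 + Real.exp 1) * (5 / 4 * (R + |x₀|)) := by
        rw [mem_sphere_iff_norm.1 hz, Complex.norm_real, Real.norm_eq_abs]
      _ ≤ R / 1000 + (1 + 2.7183) * (5 / 4 * (R + R / 1000)) := by
        gcongr
        linarith [Real.exp_one_lt_d9]
      _ ≤ 4654 / 1000 * R := by linarith
  have hσR : σ * (4654 / 1000 * R) ≤ 11 / 10 * s * (4654 / 1000 * R) := by gcongr
  have hsR : 0 ≤ s * R := mul_nonneg (by linarith) hR
  calc ‖F z‖ ≤ A * Real.exp (σ * (4654 / 1000 * R)) := (hFA z).trans (by gcongr)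
    _ ≤ c * Real.exp (8 / 100 * (s * R)) * Real.exp (512 / 100 * (s * R)) := by
      gcongr ?_ * Real.exp ?_
      · exact hA.trans hAc
      · linarith
    _ = c * Real.exp (52 / 10 * (s * R)) := by
      rw [mul_assoc, ← Real.exp_add]
      ring_nf
    _ ≤ ‖F x₀‖ * Real.exp (52 / 10 * (s * R)) := by gcongr

theorem log_div_le_one_add_mul_log {q r R m : ℝ} (hR : 0 < R) (hr : 0 < r) (hrR : r ≤ 2 * R)
    (hm : R ^ (-q + 1 / 2) ≤ m) : Real.log (r / m) ≤ 1 + (q + 1 / 2) * Real.log R := by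
  have hRq : 0 < R ^ (-q + 1 / 2) := Real.rpow_pos_of_pos hR _
  have hlogr : Real.log r ≤ Real.log 2 + Real.log R := by
    rw [← Real.log_mul two_ne_zero hR.ne']
    exact Real.log_le_log hr hrR
  have hlogm : (-q + 1 / 2) * Real.log R ≤ Real.log m := by
    rw [← Real.log_rpow hR]
    exact Real.log_le_log hRq hm
  rw [Real.log_div hr.ne' (hRq.trans_le hm).ne']
  linarith [Real.log_two_lt_d9]

theorem exp_neg_mul_lt_mul_exp_neg {c K W T l L : ℝ} (hT : 0 < T) (hl : 300 ≤ l) (hL : 0 ≤ L)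
    (hc : Real.exp (-T) ≤ c) (hK : K ≤ 11 + l) (hW : 54 / 10 * T ≤ W) :
    Real.exp (-((l + L) * W)) < c * Real.exp (-(52 / 10 * T * K)) := by
  have hlW : l * (54 / 10 * T) ≤ (l + L) * W := by
    gcongr
    linarith
  have hTl : T * 300 ≤ T * l := by gcongr
  have hTK : 52 / 10 * T * K ≤ 52 / 10 * T * (11 + l) := by gcongr
  calc Real.exp (-((l + L) * W)) < Real.exp (-T + -(52 / 10 * T * K)) :=
        Real.exp_lt_exp.2 (by linarith)
    _ ≤ c * Real.exp (-(52 / 10 * T * K)) := by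
        rw [Real.exp_add]
        gcongr

theorem log_two_le_log_fifteen_mul_exp : Real.log 2 ≤ Real.log (15 * Real.exp 1 ^ 3) :=
  Real.log_le_log two_pos
    (by linarith [one_le_pow₀ (Real.one_le_exp (zero_le_one (α := ℝ))) (n := 3)])

theorem eventually_exists_mem_exp_neg_lt_norm (x₀ : ℝ) {q A c s₁ : ℝ} (hq : -1 / 2 < q)
    (hA : 0 < A) (hc : 0 < c) (hs₁ : 0 < s₁) :
    ∀ᶠ R : ℝ in atTop, ∀ s σ : ℝ, s₁ ≤ s → 0 ≤ σ → σ ≤ 11 / 10 * s →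
      ∀ F : ℂ → ℂ, Differentiable ℂ F → c ≤ ‖F x₀‖ → (∀ z, ‖F z‖ ≤ A * Real.exp (σ * ‖z‖)) →
      ∀ E ⊆ Set.Icc (-R) R, R ^ (-q + 1 / 2) < volume.real E →
      ∃ x ∈ E, Real.exp (-(((q + 1 / 2) * Real.log R + Real.log (15 * Real.exp 1 ^ 3)) *
        (Real.log A + 2 * Real.exp 1 * s * R))) < ‖F x‖ := by
  have hlin : ∀ {b : ℝ}, 0 < b → Tendsto (fun R : ℝ => b * (s₁ * R)) atTop atTop := fun hb =>
    (tendsto_id.const_mul_atTop hs₁).const_mul_atTop hb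
  filter_upwards [
    (Real.tendsto_log_atTop.const_mul_atTop (by linarith : 0 < q + 1 / 2)).eventually_ge_atTop 300,
    (tendsto_id.atTop_div_const (by norm_num : (0 : ℝ) < 1000)).eventually_ge_atTop |x₀|,
    ((Real.tendsto_exp_atTop.comp (hlin (b := 8 / 100) (by norm_num))).const_mul_atTop
      hc).eventually_ge_atTop A,
    (hlin (b := 3 / 100) (by norm_num)).eventually_ge_atTop (-Real.log A),
    (hlin one_pos).eventually_ge_atTop (-Real.log c), eventually_gt_atTop 0]
    with R hl hx₀ hAc hlogA hlogc hR s σ hs hσ hσs F hF hFc hFA E hER hm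
  have hsR : s₁ * R ≤ s * R := by gcongr
  have hsR0 : 0 < s * R := (mul_pos hs₁ hR).trans_le hsR
  simp only [id_eq, Function.comp_apply] at hx₀ hAc
  have hAc' : A ≤ c * Real.exp (8 / 100 * (s * R)) := hAc.trans (by gcongr)
  have hr : 0 < 5 / 4 * (R + |x₀|) := by positivity
  obtain ⟨x, hxE, hx⟩ := exists_mem_norm_mul_exp_le_norm (c := (x₀ : ℂ)) hr hF.diffContOnCl
    (norm_pos_iff.1 (hc.trans_le hFc)) (by positivity : 0 < 52 / 10 * (s * R))
    (fun z hz => norm_le_norm_mul_exp_of_mem_sphere hA.le hσ hσs hFA hFc hx₀ hAc' hz)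
    (E := E) (fun h => (Real.rpow_nonneg hR.le _).not_gt (by simpa [Measure.real, h] using hm))
    (fun x hx => by
      rw [← Complex.ofReal_sub, Complex.norm_real, Real.norm_eq_abs]
      linarith [abs_sub x x₀, abs_le.2 (hER hx)])
  refine ⟨x, hxE, lt_of_lt_of_le ?_ ((mul_le_mul_of_nonneg_right hFc (Real.exp_nonneg _)).trans hx)⟩
  refine exp_neg_mul_lt_mul_exp_neg hsR0 hl
    ((Real.log_pos one_lt_two).le.trans log_two_le_log_fifteen_mul_exp) ?_ ?_ ?_
  · rw [← Real.le_log_iff_exp_le hc]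
    linarith
  · linarith [log_div_le_one_add_mul_log (q := q) hR hr (by linarith) hm.le]
  · have : 2.718 * (s * R) ≤ Real.exp 1 * (s * R) := by
      gcongr
      linarith [Real.exp_one_gt_d9]
    linarith

end ExponentialType

section RadiusEquation

variable {φ : ℝ → ℂ} {q β : ℝ}

theorem exists_radiusEquation {ε : ℝ} (hq : -1 / 2 < q) (hs : 0 < truncationRadius φ ε)
    (hε : 0 ≤ -Real.log (ε ^ β + ε)) : ∃ R : ℝ, 0 < R ∧ RadiusEquation φ q β ε R := by
  have hq' : 0 < q + 1 / 2 := by linarith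
  let G : ℝ → ℝ := fun R => ((q + 1 / 2) * Real.log R + Real.log (15 * Real.exp 1 ^ 3)) *
    (Real.log (∫ t : ℝ, ‖φ t‖) + 2 * Real.exp 1 * truncationRadius φ ε * R)
  let R₁ : ℝ := Real.exp (-Real.log (15 * Real.exp 1 ^ 3) / (q + 1 / 2))
  have hG₁ : G R₁ = 0 := by
    simp only [G, R₁, Real.log_exp, mul_div_cancel₀ _ hq'.ne', neg_add_cancel, zero_mul]
  have hlim : Tendsto G atTop atTop :=
    (tendsto_atTop_add_const_right _ _
      (Real.tendsto_log_atTop.const_mul_atTop hq')).atTop_mul_atTop₀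
      (tendsto_atTop_add_const_left _ _ (tendsto_id.const_mul_atTop (by positivity)))
  obtain ⟨R₂, hR₂, hR₁₂⟩ := ((hlim.eventually_ge_atTop (-Real.log (ε ^ β + ε))).and
    (eventually_ge_atTop R₁)).exists
  have hcont : ContinuousOn G (Set.Icc R₁ R₂) := by
    have hne : ∀ x ∈ Set.Icc R₁ R₂, x ≠ 0 := fun x hx => ((Real.exp_pos _).trans_le hx.1).ne'
    exact ((continuousOn_const.mul (continuousOn_id.log hne)).add continuousOn_const).mul
      (by fun_prop)
  obtain ⟨R, hR, hGR⟩ := intermediate_value_Icc hR₁₂ hcont ⟨hG₁.trans_le hε, hR₂⟩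
  exact ⟨R, (Real.exp_pos _).trans_le hR.1, hGR⟩

theorem eventually_exists_radiusEquation (hφ : Integrable φ) (hφ0 : ¬ φ =ᵐ[volume] 0)
    (hp : Tendsto (fun s : ℝ => tailExponent φ s / (s : EReal)) atTop (𝓝 ⊤)) (hq : -1 / 2 < q)
    (hβ : 0 < β) : ∀ᶠ ε : ℝ in 𝓝[>] 0, ∃ R : ℝ, 0 < R ∧ RadiusEquation φ q β ε R := by
  obtain ⟨s₁, hs₁, hs⟩ := exists_pos_eventually_le_truncationRadius hφ hφ0 hp
  filter_upwards [hs, (tendsto_neg_log_rpow_add_self_sub_mul_truncationRadius hp hβ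
    0).eventually_ge_atTop 0] with ε hsε hrhs
  exact exists_radiusEquation hq (hs₁.trans_le hsε) (by simpa using hrhs)

theorem eventually_lt_of_radiusEquation
    (hp : Tendsto (fun s : ℝ => tailExponent φ s / (s : EReal)) atTop (𝓝 ⊤)) (hq : -1 / 2 < q)
    (hβ : 0 < β) (M : ℝ) : ∀ᶠ ε : ℝ in 𝓝[>] 0, ∀ R : ℝ, 0 < R →
      0 ≤ (q + 1 / 2) * Real.log R + Real.log (15 * Real.exp 1 ^ 3) →
      RadiusEquation φ q β ε R → M < R := by
  let l : ℝ := (q + 1 / 2) * Real.log M + Real.log (15 * Real.exp 1 ^ 3)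
  let a : ℝ := Real.log (∫ t : ℝ, ‖φ t‖)
  filter_upwards [(tendsto_neg_log_rpow_add_self_sub_mul_truncationRadius hp hβ
    (l * (2 * Real.exp 1 * M))).eventually_gt_atTop (l * |a|)] with ε hε R hR hnonneg heq
  by_contra! hRM
  have hs := truncationRadius_nonneg φ ε
  have hlog : (q + 1 / 2) * Real.log R + Real.log (15 * Real.exp 1 ^ 3) ≤ l :=
    add_le_add_left (mul_le_mul_of_nonneg_left (Real.log_le_log hR hRM) (by linarith)) _
  have hle : -Real.log (ε ^ β + ε) ≤
      l * (|a| + 2 * Real.exp 1 * truncationRadius φ ε * M) := by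
    rw [← heq]
    have hM : 0 < M := hR.trans_le hRM
    refine (mul_le_mul_of_nonneg_left (add_le_add (le_abs_self a) ?_) hnonneg).trans
      (mul_le_mul_of_nonneg_right hlog (by positivity))
    gcongr
  linarith

theorem smallValueSet_subset (φ : ℝ → ℂ) (δ R : ℝ) : smallValueSet φ δ R ⊆ Set.Icc (-R) R :=
  fun _ hx => abs_le.1 hx.2

theorem volume_smallValueSet_le_of_log_neg (φ : ℝ → ℂ) (δ : ℝ) {R : ℝ} (hR : 0 < R)
    (hneg : (q + 1 / 2) * Real.log R + Real.log (15 * Real.exp 1 ^ 3) < 0) :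
    volume (smallValueSet φ δ R) ≤ ENNReal.ofReal (R ^ (-q + 1 / 2)) := by
  refine (measure_mono (smallValueSet_subset φ δ R)).trans ?_
  rw [Real.volume_Icc]
  refine ENNReal.ofReal_le_ofReal ?_
  have hpow : R ^ (q + 1 / 2) ≤ 1 / 2 := by
    rw [← Real.log_le_log_iff (Real.rpow_pos_of_pos hR _) (by norm_num), Real.log_rpow hR,
      one_div, Real.log_inv]
    linarith [log_two_le_log_fifteen_mul_exp]
  calc R - -R = 2 * (R ^ (q + 1 / 2) * R ^ (-q + 1 / 2)) := by
        rw [← Real.rpow_add hR, add_add_add_comm, add_neg_cancel, add_halves, zero_add,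
          Real.rpow_one]
        ring
    _ ≤ 2 * (1 / 2 * R ^ (-q + 1 / 2)) := by gcongr
    _ = R ^ (-q + 1 / 2) := by ring

theorem exists_fourierLaplace_approximation (hφ : Integrable φ) {ε t : ℝ} (hε : 0 ≤ ε)
    (hne : (truncationSet φ ε).Nonempty) (ht : truncationRadius φ ε < t) :
    ∃ F : ℂ → ℂ, Differentiable ℂ F ∧ (∀ z, ‖F z‖ ≤ (∫ u, ‖φ u‖) * Real.exp (t * ‖z‖)) ∧
      ∀ x : ℝ, ‖F x - fourierHat φ x‖ ≤ ε := by
  obtain ⟨s, hs, hst⟩ := exists_mem_truncationSet_lt hne ht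
  let ψ : ℝ → ℂ := {u : ℝ | s ≤ |u|}ᶜ.indicator φ
  have hψ : Integrable ψ := hφ.indicator (measurableSet_le_abs s).compl
  have hψs : Function.support ψ ⊆ Set.Icc (-s) s := fun u hu =>
    abs_le.1 (not_le.1 (show ¬s ≤ |u| from Set.mem_of_indicator_ne_zero hu)).le
  refine ⟨fourierLaplace ψ, differentiable_fourierLaplace hψ hψs, fun z => ?_, fun x => by
    rw [fourierLaplace_ofReal]
    exact norm_fourierHat_indicator_sub_le hφ hε hs x⟩
  have hψφ : ∫ u, ‖ψ u‖ ≤ ∫ u, ‖φ u‖ :=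
    integral_mono hψ.norm hφ.norm fun u => norm_indicator_le_norm_self φ u
  exact (norm_fourierLaplace_le hψ hψs z).trans (by gcongr)

theorem eventually_volume_smallValueSet_le (hφ : Integrable φ) {x₀ s₁ : ℝ}
    (hx₀ : fourierHat φ x₀ ≠ 0) (hq : -1 / 2 < q) (hs₁ : 0 < s₁) :
    ∀ᶠ R : ℝ in atTop, ∀ β ε : ℝ, 0 < ε → ε ≤ ‖fourierHat φ x₀‖ / 2 →
      (truncationSet φ ε).Nonempty → s₁ ≤ truncationRadius φ ε → RadiusEquation φ q β ε R →
      volume (smallValueSet φ (ε ^ β) R) ≤ ENNReal.ofReal (R ^ (-q + 1 / 2)) := by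
  have hc : 0 < ‖fourierHat φ x₀‖ := norm_pos_iff.2 hx₀
  filter_upwards [eventually_exists_mem_exp_neg_lt_norm x₀ hq
    (hc.trans_le (norm_fourierHat_le φ x₀)) (half_pos hc) hs₁, eventually_ge_atTop 0]
    with R hR hR0 β ε hε hεc hne hs heq
  obtain ⟨F, hF, hFA, hFφ⟩ := exists_fourierLaplace_approximation hφ hε.le hne
    (show truncationRadius φ ε < 11 / 10 * truncationRadius φ ε by linarith)
  by_contra! hlt
  have hm : R ^ (-q + 1 / 2) < volume.real (smallValueSet φ (ε ^ β) R) :=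
    (ENNReal.ofReal_lt_iff_lt_toReal (Real.rpow_nonneg hR0 _)
      ((measure_mono (smallValueSet_subset φ _ R)).trans_lt (by simp)).ne).1 hlt
  obtain ⟨x, hx, hlow⟩ := hR _ _ hs (by linarith) le_rfl F hF
    (by linarith [norm_sub_norm_le (fourierHat φ x₀) (F x₀), norm_sub_rev (F x₀) (fourierHat φ x₀),
      hFφ x₀]) hFA _ (smallValueSet_subset φ _ R) hm
  rw [heq, neg_neg, Real.exp_log (by positivity)] at hlow
  linarith [norm_sub_norm_le (F x) (fourierHat φ x), hFφ x, hx.1]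

end RadiusEquation

end Deconvolution

open Deconvolution in
theorem theorem5_general (φ : ℝ → ℂ) (hφ : Integrable φ volume) (hφ0 : ¬ φ =ᵐ[volume] 0)
    (hp : Tendsto (fun s : ℝ => tailExponent φ s / (s : EReal)) atTop (𝓝 ⊤))
    (q β : ℝ) (hq : -1 / 2 < q) (hβ : 0 < β) :
    ∃ ε₀ : ℝ, 0 < ε₀ ∧ ∀ ε : ℝ, 0 < ε → ε < ε₀ →
      (∃ R : ℝ, 0 < R ∧ RadiusEquation φ q β ε R) ∧
      ∀ R : ℝ, 0 < R → RadiusEquation φ q β ε R →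
        volume (smallValueSet φ (ε ^ β) R) ≤ ENNReal.ofReal (R ^ (-q + 1 / 2)) := by
  obtain ⟨x₀, hx₀⟩ := exists_fourierHat_ne_zero hφ hφ0
  obtain ⟨s₁, hs₁, hs⟩ := exists_pos_eventually_le_truncationRadius hφ hφ0 hp
  obtain ⟨M, hM⟩ := eventually_atTop.1 (eventually_volume_smallValueSet_le hφ hx₀ hq hs₁)
  have hall : ∀ᶠ ε : ℝ in 𝓝[>] 0, (∃ R : ℝ, 0 < R ∧ RadiusEquation φ q β ε R) ∧
      ∀ R : ℝ, 0 < R → RadiusEquation φ q β ε R →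
        volume (smallValueSet φ (ε ^ β) R) ≤ ENNReal.ofReal (R ^ (-q + 1 / 2)) := by
    filter_upwards [eventually_exists_radiusEquation hφ hφ0 hp hq hβ,
      eventually_lt_of_radiusEquation hp hq hβ M, hs, eventually_truncationSet_nonempty hp,
      Ioo_mem_nhdsGT (half_pos (norm_pos_iff.2 hx₀))] with ε hex hlarge hsε hne ⟨hε, hεx₀⟩
    refine ⟨hex, fun R hR heq => ?_⟩
    rcases lt_or_ge ((q + 1 / 2) * Real.log R + Real.log (15 * Real.exp 1 ^ 3)) 0 with hneg | hnn
    · exact volume_smallValueSet_le_of_log_neg φ _ hR hneg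
    · exact hM R (hlarge R hR hnn heq).le β ε hε hεx₀.le hne hsε heq
  obtain ⟨ε₀, hε₀, hsub⟩ := mem_nhdsGT_iff_exists_Ioo_subset.1 hall
  exact ⟨ε₀, hε₀, fun ε hε hεlt => hsub ⟨hε, hεlt⟩⟩

theorem theorem5 (φ : ℝ → ℂ) (hφ : Integrable φ volume) (hφ0 : ¬ φ =ᵐ[volume] 0)
    (hp : Tendsto (fun s : ℝ => Deconvolution.tailExponent φ s / (s : EReal)) atTop (𝓝 ⊤))
    (q β : ℝ) (hq : 1 / 2 < q) (hβ : 0 < β) :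
    ∃ ε₀ : ℝ, 0 < ε₀ ∧ ∀ ε : ℝ, 0 < ε → ε < ε₀ →
      (∃ R : ℝ, 0 < R ∧ Deconvolution.RadiusEquation φ q β ε R) ∧
      ∀ R : ℝ, 0 < R → Deconvolution.RadiusEquation φ q β ε R →
        volume (Deconvolution.smallValueSet φ (ε ^ β) R) ≤ ENNReal.ofReal (R ^ (-q + 1 / 2)) :=
  theorem5_general φ hφ hφ0 hp q β (by linarith) hβ
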